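/- **Setting.** Let $1<c<\infty$ and $0<s<\infty$, and for $x,y\in\mathbb R^d$ put $D(x,y)=\|x-y\|_s=\big(\sum_{i=1}^d|x_i-y_i|^s\big)^{1/s}$; write $\ell_s^d=(\mathbb R^d,D)$. A *filter family* for $\ell_s^d$ is a probability distribution over pairs $(Q,U)$ of subsets of $\mathbb R^d$. It is *symmetric* if $Q=U$ (almost surely), and *$(r,cr,p_1,p_2,p_q,p_u)$-sensitive* if for all $x,y\in\mathbb R^d$ and $(Q,U)$ sampled from it: - if $D(x,y)\le r$ then $\Pr[x\in Q,\ y\in U]\ge p_1$; - if $D(x,y)>cr$ then $\Pr[x\in Q,\ y\in U]\le p_2$; - $\Pr[x\in Q]\le p_q$ and $\Pr[x\in U]\le p_u$. **Theorem 1.4.** Fix $1<c<\infty$, $0<s<\infty$ and a sequence $\delta_d\to 0$. There are sequences $(r_d)$ and $(\varepsilon_d)$, depending only on $c$, $s$ and $(\delta_d)$, with $r_d\to\infty$, $r_d^s/d\to 0$ and $\varepsilon_d\to 0$ as $d\to\infty$, such that for every $d$ and every symmetric $(r_d,c\,r_d,p_1,p_2,p_q,p_u)$-sensitive filter family for $\ell_s^d$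 with $p_1>0$, the numbers $p=p_1/p_q$ and $q=p_2/p_q$ satisfy the following: if $0<q<1$ and $q\ge 2^{-\delta_d d}$, then $$\rho=\frac{\log(1/p)}{\log(1/q)}=\frac{\log(p_q/p_1)}{\log(p_q/p_2)}\ \ge\ \frac1{c^s}-\varepsilon_d .$$ -/

import Mathlib

open Filter Topology MeasureTheory

/-- The `ℓ_s` distance `(∑ i, |x i - y i| ^ s) ^ (1 / s)` on `ℝ^d`
(a genuine metric for `s ≥ 1`, a dissimilarity measure for `0 < s < 1`). -/
noncomputable def lsDist (s : ℝ) {d : ℕ} (x y : Fin d → ℝ) : ℝ :=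
  (∑ i, |x i - y i| ^ s) ^ (1 / s)

/-- A filter family for `X`: a random pair `(query ω, update ω)` of subsets of `X`, on a
probability space, such that the events "`x` lies in the query filter" and "`x` lies in the
update filter" are measurable for every point `x`. -/
structure FilterFamily (X : Type*) where
  /-- the sample space -/
  Ω : Type*
  /-- its events -/
  [mΩ : MeasurableSpace Ω]
  /-- the probability -/
  P : Measure Ω
  [isProb : IsProbabilityMeasure P]
  /-- the random query filter `Q` -/
  query : Ω → Set X
  /-- the random update filter `U` -/
  update : Ω → Set X
  measurableSet_query : ∀ x, MeasurableSet {ω | x ∈ query ω}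
  measurableSet_update : ∀ x, MeasurableSet {ω | x ∈ update ω}

namespace FilterFamily

attribute [instance] FilterFamily.mΩ FilterFamily.isProb

variable {X : Type*}

/-- The family is symmetric: the sampled filter almost surely has `Q = U`. -/
def IsSymmetric (F : FilterFamily X) : Prop :=
  ∀ᵐ ω ∂F.P, F.query ω = F.update ω

/-- The family is `(r, R, p₁, p₂, pq, pu)`-sensitive with respect to the dissimilarity `D`. -/
structure IsSensitive (F : FilterFamily X) (D : X → X → ℝ) (r R p₁ p₂ pq pu : ℝ) : Prop where
  close : ∀ x y, D x y ≤ r → p₁ ≤ F.P.real {ω | x ∈ F.query ω ∧ y ∈ F.update ω}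
  far : ∀ x y, R < D x y → F.P.real {ω | x ∈ F.query ω ∧ y ∈ F.update ω} ≤ p₂
  query_le : ∀ x, F.P.real {ω | x ∈ F.query ω} ≤ pq
  update_le : ∀ x, F.P.real {ω | x ∈ F.update ω} ≤ pu

end FilterFamily

/-! On the cube `{0,1}^d` the distance is the Hamming distance to the power `1/s`. By symmetry `h x
y = Pr[x ∈ Q, y ∈ Q]` is a Gram kernel, hence positive semidefinite, so its noise stability is `∑ S,
w_S ρ^|S|` with all `w_S ≥ 0`. Hölder's inequality then gives `S(ρ) ≤ S(1)^(1-1/κ) S(ρ^κ)^(1/κ)`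
(`noiseStability_le_rpow_mul_rpow`).

Noise `exp(-τ)` moves a point by about `τd/2` for small `τ`, so with `κ` slightly above `c^s` the
correlations `ρ` and `ρ^κ` correspond to distances just below `r^s` and just above `(cr)^s`.
Chernoff bounds turn the inequality into `p₁ ≲ pq^(1-1/κ) p₂^(1/κ)`, which is the claim up to
constant factors.

These constants would be fatal for `q` near 1. The Schur product theorem allows `h` to be replaced
by its entrywise power `h^k`, which raises all the probabilities to the power `k`. Choosing `k
log(1/q)` large, yet small enough for the Chernoff tail to stay below `q^k`, makes the loss vanish.
-/

/-! ### The noise kernel on the discrete cube -/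

/-- The sign of a bit. -/
def bitSign (b : Bool) : ℝ := if b then -1 else 1

/-- The probability that a `ρ`-correlated copy of `x` on the discrete cube equals `y`. -/
noncomputable def noiseKernel {ι : Type*} [Fintype ι] (ρ : ℝ) (x y : ι → Bool) : ℝ :=
  ∏ i, (1 + ρ * (bitSign (x i) * bitSign (y i))) / 2

section Cube

variable {ι : Type*} [Fintype ι]

lemma noiseKernel_nonneg {ρ : ℝ} (h₀ : 0 ≤ ρ) (h₁ : ρ ≤ 1) (x y : ι → Bool) :
    0 ≤ noiseKernel ρ x y := by
  refine Finset.prod_nonneg fun i _ => ?_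
  cases x i <;> cases y i <;> simp [bitSign] <;> linarith

/-- Expanding the product over coordinates diagonalises the kernel in the Walsh basis, with
eigenvalues `ρ ^ S.card`. -/
lemma noiseKernel_eq_sum (ρ : ℝ) (x y : ι → Bool) :
    noiseKernel ρ x y = (1 / 2) ^ Fintype.card ι * ∑ S : Finset ι,
      ρ ^ S.card * ((∏ i ∈ S, bitSign (x i)) * ∏ i ∈ S, bitSign (y i)) := by
  simp_rw [noiseKernel, Finset.prod_div_distrib, Finset.prod_one_add, Finset.prod_mul_distrib,
    Finset.prod_const, Finset.powerset_univ, Finset.card_univ]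
  rw [div_eq_inv_mul, one_div, inv_pow]

variable [DecidableEq ι]

/-- Coordinates flip independently with probability `(1 - ρ) / 2`, so the moment generating function
factorises. -/
lemma sum_noiseKernel_mul_exp_hammingDist (ρ t : ℝ) (x : ι → Bool) :
    ∑ y, noiseKernel ρ x y * Real.exp (t * hammingDist x y) =
      (1 + (1 - ρ) / 2 * (Real.exp t - 1)) ^ Fintype.card ι := by
  have key : ∀ y : ι → Bool, noiseKernel ρ x y * Real.exp (t * hammingDist x y) =
      ∏ i, ((1 + ρ * (bitSign (x i) * bitSign (y i))) / 2 *
        if x i ≠ y i then Real.exp t else 1) := by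
    intro y
    rw [Finset.prod_mul_distrib, noiseKernel, Finset.prod_ite, Finset.prod_const,
      Finset.prod_const_one, mul_one, hammingDist, mul_comm t, Real.exp_nat_mul]
  simp_rw [key]
  rw [← Fintype.piFinset_univ, ← Finset.prod_univ_sum (fun _ => Finset.univ)
    (fun i b => (1 + ρ * (bitSign (x i) * bitSign b)) / 2 * if x i ≠ b then Real.exp t else 1),
    ← Finset.card_univ, ← Finset.prod_const]
  refine Finset.prod_congr rfl fun i _ => ?_
  cases x i <;> simp [bitSign] <;> ring

lemma sum_noiseKernel (ρ : ℝ) (x : ι → Bool) : ∑ y, noiseKernel ρ x y = 1 := by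
  simpa using sum_noiseKernel_mul_exp_hammingDist ρ 0 x

/-- The Chernoff bound for the Hamming distance of correlated points of the cube, for both tails
(`t > 0` and `t < 0`). -/
lemma sum_noiseKernel_filter_le {ρ : ℝ} (h₀ : 0 ≤ ρ) (h₁ : ρ ≤ 1) (t a : ℝ) (x : ι → Bool) :
    ∑ y with t * a ≤ t * hammingDist x y, noiseKernel ρ x y ≤
      Real.exp (Fintype.card ι * ((1 - ρ) / 2 * (Real.exp t - 1)) - t * a) := by
  have hb : 0 ≤ 1 + (1 - ρ) / 2 * (Real.exp t - 1) := by nlinarith [Real.exp_pos t]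
  calc ∑ y with t * a ≤ t * hammingDist x y, noiseKernel ρ x y
      ≤ ∑ y with t * a ≤ t * hammingDist x y,
          noiseKernel ρ x y * Real.exp (t * hammingDist x y) * Real.exp (-(t * a)) := by
        refine Finset.sum_le_sum fun y hy => ?_
        rw [mul_assoc, ← Real.exp_add]
        refine le_mul_of_one_le_right (noiseKernel_nonneg h₀ h₁ x y) (Real.one_le_exp ?_)
        linarith [(Finset.mem_filter.1 hy).2]
    _ ≤ ∑ y, noiseKernel ρ x y * Real.exp (t * hammingDist x y) * Real.exp (-(t * a)) := by
        refine Finset.sum_le_sum_of_subset_of_nonneg (Finset.filter_subset _ _) fun y _ _ => ?_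
        have := noiseKernel_nonneg h₀ h₁ x y
        positivity
    _ = (1 + (1 - ρ) / 2 * (Real.exp t - 1)) ^ Fintype.card ι * Real.exp (-(t * a)) := by
        rw [← Finset.sum_mul, sum_noiseKernel_mul_exp_hammingDist]
    _ ≤ Real.exp ((1 - ρ) / 2 * (Real.exp t - 1)) ^ Fintype.card ι * Real.exp (-(t * a)) := by
        gcongr
        linarith [Real.add_one_le_exp ((1 - ρ) / 2 * (Real.exp t - 1))]
    _ = _ := by rw [← Real.exp_nat_mul, ← Real.exp_add, ← sub_eq_add_neg]

/-- The noise stability of a kernel on the discrete cube. -/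
noncomputable def noiseStability (h : Matrix (ι → Bool) (ι → Bool) ℝ) (ρ : ℝ) : ℝ :=
  ∑ x, ∑ y, noiseKernel ρ x y * h x y

/-- The quadratic form of a kernel at the Walsh function of `S`. -/
noncomputable def walshForm (h : Matrix (ι → Bool) (ι → Bool) ℝ) (S : Finset ι) : ℝ :=
  ∑ x, ∑ y, h x y * ((∏ i ∈ S, bitSign (x i)) * ∏ i ∈ S, bitSign (y i))

lemma noiseStability_eq_sum (h : Matrix (ι → Bool) (ι → Bool) ℝ) (ρ : ℝ) :
    noiseStability h ρ = ∑ S, (1 / 2) ^ Fintype.card ι * walshForm h S * ρ ^ S.card := by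
  simp_rw [noiseStability, walshForm, noiseKernel_eq_sum, Finset.mul_sum, Finset.sum_mul]
  conv_rhs => rw [Finset.sum_comm]
  refine Finset.sum_congr rfl fun x _ => ?_
  rw [Finset.sum_comm]
  refine Finset.sum_congr rfl fun S _ => ?_
  refine Finset.sum_congr rfl fun y _ => ?_
  ring

/-- Noise stability of a positive semidefinite kernel is log-convex in the noise rate. -/
lemma noiseStability_le_rpow_mul_rpow {h : Matrix (ι → Bool) (ι → Bool) ℝ} (hh : h.PosSemidef)
    {ρ κ : ℝ} (hρ : 0 ≤ ρ) (hκ : 1 ≤ κ) :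
    noiseStability h ρ ≤
      noiseStability h 1 ^ (1 - κ⁻¹) * noiseStability h (ρ ^ κ) ^ κ⁻¹ := by
  have hW : ∀ S, 0 ≤ (1 / 2) ^ Fintype.card ι * walshForm h S := fun S => by
    refine mul_nonneg (by positivity) ?_
    have := hh.dotProduct_mulVec_nonneg fun x => ∏ i ∈ S, bitSign (x i)
    simp only [dotProduct, Matrix.mulVec, Finset.mul_sum, star_trivial] at this
    refine this.trans_eq ?_
    rw [walshForm]
    refine Finset.sum_congr rfl fun x _ => Finset.sum_congr rfl fun y _ => ?_
    ring
  -- Weighted Hölder with weights `w_S`, which is where their nonnegativity enters.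
  have := Real.inner_le_weight_mul_Lp_of_nonneg Finset.univ hκ _ (fun S => ρ ^ S.card) hW
    fun S => pow_nonneg hρ _
  simp_rw [noiseStability_eq_sum h, one_pow, mul_one]
  refine this.trans_eq ?_
  congr 2
  refine Finset.sum_congr rfl fun S _ => ?_
  rw [← Real.rpow_natCast ρ, ← Real.rpow_natCast (ρ ^ κ), ← Real.rpow_mul hρ, ← Real.rpow_mul hρ,
    mul_comm κ]

end Cube

/-! ### Positive semidefiniteness -/

/-- The quadratic form at `v` is the second moment of `∑ x, v x * 1_{A x}`. -/
lemma posSemidef_measureReal_inter {Ω V : Type*} [MeasurableSpace Ω] [Fintype V] (P : Measure Ω)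
    [IsFiniteMeasure P] (A : V → Set Ω) (hA : ∀ x, MeasurableSet (A x)) :
    (Matrix.of fun x y => P.real (A x ∩ A y)).PosSemidef := by
  refine .of_dotProduct_mulVec_nonneg ?_ fun v => ?_
  · ext x y
    simp [Set.inter_comm]
  · have hint : ∀ x y, Integrable
        (fun ω => v x * v y * (A x ∩ A y).indicator (fun _ => (1 : ℝ)) ω) P := fun x y =>
      ((integrable_const (1 : ℝ)).indicator ((hA x).inter (hA y))).const_mul _
    have key : star v ⬝ᵥ ((Matrix.of fun x y => P.real (A x ∩ A y)).mulVec v) =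
        ∫ ω, (∑ x, v x * (A x).indicator (fun _ => (1 : ℝ)) ω) ^ 2 ∂P := by
      calc _ = ∑ x, ∑ y, ∫ ω, v x * v y * (A x ∩ A y).indicator (fun _ => (1 : ℝ)) ω ∂P := by
            simp only [dotProduct, Matrix.mulVec, Finset.mul_sum, star_trivial, Matrix.of_apply]
            refine Finset.sum_congr rfl fun x _ => Finset.sum_congr rfl fun y _ => ?_
            rw [integral_const_mul, integral_indicator_const _ ((hA x).inter (hA y))]
            simp only [smul_eq_mul]
            ring
        _ = ∫ ω, ∑ x, ∑ y, v x * v y * (A x ∩ A y).indicator (fun _ => (1 : ℝ)) ω ∂P := by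
            rw [integral_finsetSum _ fun x _ => integrable_finsetSum _ fun y _ => hint x y]
            exact Finset.sum_congr rfl fun x _ => (integral_finsetSum _ fun y _ => hint x y).symm
        _ = _ := by
            congr 1
            ext ω
            rw [sq, Finset.sum_mul_sum]
            refine Finset.sum_congr rfl fun x _ => Finset.sum_congr rfl fun y _ => ?_
            have : (A x ∩ A y).indicator (fun _ => (1 : ℝ)) ω =
                (A x).indicator (fun _ => (1 : ℝ)) ω * (A y).indicator (fun _ => (1 : ℝ)) ω := by
              by_cases h₁ : ω ∈ A x <;> by_cases h₂ : ω ∈ A y <;> simp [h₁, h₂]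
            rw [this]
            ring
    rw [key]
    exact integral_nonneg fun ω => sq_nonneg _

/-- Schur product theorem; for filters, this amounts to intersecting `k` independent copies. -/
lemma Matrix.PosSemidef.map_pow {V : Type*} {h : Matrix V V ℝ} (hh : h.PosSemidef) {k : ℕ}
    (hk : 1 ≤ k) : (h.map (· ^ k)).PosSemidef := by
  induction k, hk using Nat.le_induction with
  | base => simpa using hh
  | succ k _ ih =>
    have : h.map (· ^ (k + 1)) = (h.map (· ^ k)).hadamard h := by
      ext
      simp [pow_succ]
    rw [this]
    exact ih.hadamard hh

/-! ### The two-point inequality for locality-sensitive kernels -/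

section Sensitive

variable {ι : Type*} [Fintype ι] [DecidableEq ι]

lemma noiseStability_le {h : Matrix (ι → Bool) (ι → Bool) ℝ} {ρ : ℝ} (h₀ : 0 ≤ ρ) (h₁ : ρ ≤ 1)
    {u v ε : ℝ} {a : ℝ} (hu : ∀ x y, h x y ≤ u) (hv : ∀ x y, a < hammingDist x y → h x y ≤ v)
    (hu₀ : 0 ≤ u) (hv₀ : 0 ≤ v)
    (hε : ∀ x : ι → Bool, ∑ y with (hammingDist x y : ℝ) ≤ a, noiseKernel ρ x y ≤ ε) :
    noiseStability h ρ ≤ Fintype.card (ι → Bool) * (v + ε * u) := by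
  rw [← nsmul_eq_mul, ← Finset.card_univ]
  refine Finset.sum_le_card_nsmul _ _ _ fun x _ => ?_
  rw [← Finset.sum_filter_add_sum_filter_not Finset.univ
    (fun y => (hammingDist x y : ℝ) ≤ a), add_comm]
  refine add_le_add ?_ ?_
  · calc _ ≤ ∑ y with ¬ (hammingDist x y : ℝ) ≤ a, noiseKernel ρ x y * v := by
          refine Finset.sum_le_sum fun y hy => mul_le_mul_of_nonneg_left
            (hv x y (not_le.1 (Finset.mem_filter.1 hy).2)) (noiseKernel_nonneg h₀ h₁ x y)
      _ ≤ ∑ y, noiseKernel ρ x y * v :=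
          Finset.sum_le_sum_of_subset_of_nonneg (Finset.filter_subset _ _) fun y _ _ =>
            mul_nonneg (noiseKernel_nonneg h₀ h₁ x y) hv₀
      _ = v := by rw [← Finset.sum_mul, sum_noiseKernel, one_mul]
  · calc _ ≤ ∑ y with (hammingDist x y : ℝ) ≤ a, noiseKernel ρ x y * u := by
          refine Finset.sum_le_sum fun y hy => mul_le_mul_of_nonneg_left
            (hu x y) (noiseKernel_nonneg h₀ h₁ x y)
      _ ≤ ε * u := by
          rw [← Finset.sum_mul]
          exact mul_le_mul_of_nonneg_right (hε x) hu₀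

lemma le_noiseStability {h : Matrix (ι → Bool) (ι → Bool) ℝ} {ρ : ℝ} (h₀ : 0 ≤ ρ) (h₁ : ρ ≤ 1)
    {v ε : ℝ} {a : ℝ} (hh : ∀ x y, 0 ≤ h x y) (hv : ∀ x y, hammingDist x y ≤ a → v ≤ h x y)
    (hv₀ : 0 ≤ v)
    (hε : ∀ x : ι → Bool, ∑ y with a ≤ hammingDist x y, noiseKernel ρ x y ≤ ε) :
    Fintype.card (ι → Bool) * ((1 - ε) * v) ≤ noiseStability h ρ := by
  rw [← nsmul_eq_mul, ← Finset.card_univ]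
  refine Finset.card_nsmul_le_sum _ _ _ fun x _ => ?_
  calc (1 - ε) * v ≤ (∑ y with ¬ a ≤ hammingDist x y, noiseKernel ρ x y) * v := by
        refine mul_le_mul_of_nonneg_right ?_ hv₀
        have := Finset.sum_filter_add_sum_filter_not Finset.univ
          (fun y => a ≤ hammingDist x y) (noiseKernel ρ x)
        rw [sum_noiseKernel] at this
        linarith [hε x]
    _ ≤ ∑ y with ¬ a ≤ hammingDist x y, noiseKernel ρ x y * h x y := by
        rw [Finset.sum_mul]
        exact Finset.sum_le_sum fun y hy => mul_le_mul_of_nonneg_left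
          (hv x y (not_le.1 (Finset.mem_filter.1 hy).2).le) (noiseKernel_nonneg h₀ h₁ x y)
    _ ≤ _ := Finset.sum_le_sum_of_subset_of_nonneg (Finset.filter_subset _ _) fun y _ _ =>
        mul_nonneg (noiseKernel_nonneg h₀ h₁ x y) (hh x y)

/-- For a positive semidefinite kernel bounded by `u`, which is at least `v₁` at Hamming distances
up to `a₁` and at most `v₂` at distances beyond `a₂`, the value `v₁` is controlled by `u` and `v₂`,
when noise of correlation `ρ` usually moves points by less than `a₁`, and noise of correlation
`ρ ^ κ` rarely by at most `a₂`. -/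
lemma half_le_rpow_mul_rpow_of_posSemidef {h : Matrix (ι → Bool) (ι → Bool) ℝ}
    (hh : h.PosSemidef) {ρ κ : ℝ} (h₀ : 0 ≤ ρ) (h₁ : ρ ≤ 1) (hκ : 1 ≤ κ) {v₁ v₂ u a₁ a₂ : ℝ}
    (hv₁ : 0 ≤ v₁) (hv₂ : 0 ≤ v₂) (hu : 0 < u)
    (hpos : ∀ x y, 0 ≤ h x y) (hle : ∀ x y, h x y ≤ u)
    (hclose : ∀ x y, hammingDist x y ≤ a₁ → v₁ ≤ h x y)
    (hfar : ∀ x y, a₂ < hammingDist x y → h x y ≤ v₂)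
    (hε₁ : ∀ x : ι → Bool, ∑ y with a₁ ≤ hammingDist x y, noiseKernel ρ x y ≤ 1 / 2)
    (hε₂ : ∀ x : ι → Bool,
      ∑ y with (hammingDist x y : ℝ) ≤ a₂, noiseKernel (ρ ^ κ) x y ≤ v₂ / u) :
    v₁ / 2 ≤ u ^ (1 - κ⁻¹) * (2 * v₂) ^ κ⁻¹ := by
  have hκ₀ : 0 ≤ κ := by linarith
  have hκ' : 0 ≤ κ⁻¹ := inv_nonneg.2 hκ₀
  have hκ₁ : 0 ≤ 1 - κ⁻¹ := sub_nonneg.2 (inv_le_one_of_one_le₀ hκ)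
  have hN : (0 : ℝ) < Fintype.card (ι → Bool) := by exact_mod_cast Fintype.card_pos
  set N : ℝ := (Fintype.card (ι → Bool) : ℝ)
  have b₁ := le_noiseStability h₀ h₁ hpos hclose hv₁ hε₁
  have b₂ := noiseStability_le (Real.rpow_nonneg h₀ κ) (Real.rpow_le_one h₀ h₁ hκ₀) hle hfar
    hu.le hv₂ hε₂
  -- No point lies at Hamming distance at most `-1`, so this is the trivial bound `S(1) ≤ N u`.
  have b₃ := noiseStability_le (a := -1) (v := u) (ε := 0) zero_le_one le_rfl hle
    (fun x y _ => hle x y) hu.le hu.le fun x => by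
      rw [Finset.filter_false_of_mem, Finset.sum_empty]
      intro y _
      have : (0 : ℝ) ≤ hammingDist x y := Nat.cast_nonneg _
      linarith
  have hst : ∀ {η : ℝ}, 0 ≤ η → η ≤ 1 → 0 ≤ noiseStability h η := fun h₀ h₁ =>
    Finset.sum_nonneg fun x _ => Finset.sum_nonneg fun y _ =>
      mul_nonneg (noiseKernel_nonneg h₀ h₁ x y) (hpos x y)
  have key := noiseStability_le_rpow_mul_rpow hh h₀ hκ
  have : N * (v₁ / 2) ≤ N * (u ^ (1 - κ⁻¹) * (2 * v₂) ^ κ⁻¹) := by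
    calc N * (v₁ / 2) = N * ((1 - 1 / 2) * v₁) := by ring
      _ ≤ _ := b₁.trans key
      _ ≤ (N * u) ^ (1 - κ⁻¹) * (N * (2 * v₂)) ^ κ⁻¹ := by
        refine mul_le_mul (Real.rpow_le_rpow (hst zero_le_one le_rfl) ?_ hκ₁)
          (Real.rpow_le_rpow (hst (Real.rpow_nonneg h₀ κ) (Real.rpow_le_one h₀ h₁ hκ₀)) ?_ hκ')
          (Real.rpow_nonneg (hst (Real.rpow_nonneg h₀ κ) (Real.rpow_le_one h₀ h₁ hκ₀)) _)
          (by positivity)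
        · simpa [N] using b₃
        · rw [div_mul_cancel₀ _ hu.ne', ← two_mul] at b₂
          exact b₂
      _ = _ := by
        rw [Real.mul_rpow hN.le hu.le, Real.mul_rpow hN.le (by positivity), mul_mul_mul_comm,
          ← Real.rpow_add hN, sub_add_cancel, Real.rpow_one]
  exact le_of_mul_le_mul_left this hN

end Sensitive

/-! ### The cube in `ℓ_s` -/

/-- The embedding of the discrete cube into `ℝ^d`. -/
def cubePoint {d : ℕ} (x : Fin d → Bool) : Fin d → ℝ := fun i => if x i then 1 else 0

lemma lsDist_cubePoint {s : ℝ} (hs : 0 < s) {d : ℕ} (x y : Fin d → Bool) :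
    lsDist s (cubePoint x) (cubePoint y) = (hammingDist x y : ℝ) ^ (1 / s) := by
  rw [lsDist, hammingDist, Finset.card_filter]
  push_cast
  congr 1
  refine Finset.sum_congr rfl fun i _ => ?_
  cases hx : x i <;> cases hy : y i <;> simp [cubePoint, hx, hy, hs.ne']

/-- This follows from `(1 + x + x²/2)(1 - x + x²/2) = 1 + x⁴/4 ≥ 1`. -/
lemma exp_neg_le_one_sub_add_sq {x : ℝ} (hx : 0 ≤ x) : Real.exp (-x) ≤ 1 - x + x ^ 2 / 2 := by
  have := Real.quadratic_le_exp_of_nonneg hx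
  rw [Real.exp_neg, inv_le_iff_one_le_mul₀ (Real.exp_pos x)]
  nlinarith [sq_nonneg x, sq_nonneg (x - 1), mul_nonneg hx (sq_nonneg x), sq_nonneg (x ^ 2)]

namespace FilterFamily

variable {X : Type*} {F : FilterFamily X} {D : X → X → ℝ} {r R p₁ p₂ pq pu : ℝ}

lemma IsSymmetric.measureReal_eq (hF : F.IsSymmetric) (x y : X) :
    F.P.real {ω | x ∈ F.query ω ∧ y ∈ F.update ω} =
      F.P.real ({ω | x ∈ F.query ω} ∩ {ω | y ∈ F.query ω}) := by
  refine measureReal_congr ?_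
  filter_upwards [hF] with ω hω
  change (_ ∈ _ ∧ _ ∈ _) = (_ ∈ F.query ω ∧ _ ∈ F.query ω)
  rw [hω]

lemma IsSensitive.measureReal_le (hF : F.IsSensitive D r R p₁ p₂ pq pu) (x y : X) :
    F.P.real {ω | x ∈ F.query ω ∧ y ∈ F.update ω} ≤ pq :=
  (measureReal_mono fun _ h => h.1).trans (hF.query_le x)

/-- The tensor-power form of the two-point inequality, for filters on the cube in `ℓ_s`. -/
lemma IsSensitive.half_pow_le {s : ℝ} (hs : 0 < s) {d : ℕ} {F : FilterFamily (Fin d → ℝ)}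
    (hsym : F.IsSymmetric) (hF : F.IsSensitive (lsDist s) r R p₁ p₂ pq pu)
    (hr : 0 ≤ r) (hR : 0 ≤ R) (hp₁ : 0 ≤ p₁) (hp₂ : 0 ≤ p₂) (hpq : 0 < pq) {k : ℕ} (hk : 1 ≤ k)
    {ρ κ : ℝ} (h₀ : 0 ≤ ρ) (h₁ : ρ ≤ 1) (hκ : 1 ≤ κ)
    (hε₁ : ∀ x : Fin d → Bool, ∑ y with r ^ s ≤ hammingDist x y, noiseKernel ρ x y ≤ 1 / 2)
    (hε₂ : ∀ x : Fin d → Bool,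
      ∑ y with (hammingDist x y : ℝ) ≤ R ^ s, noiseKernel (ρ ^ κ) x y ≤ (p₂ / pq) ^ k) :
    p₁ ^ k / 2 ≤ (pq ^ k) ^ (1 - κ⁻¹) * (2 * p₂ ^ k) ^ κ⁻¹ := by
  have hpsd := (posSemidef_measureReal_inter F.P
    (fun x : Fin d → Bool => {ω | cubePoint x ∈ F.query ω})
    fun x => F.measurableSet_query _).map_pow hk
  have hdist : ∀ {a : ℝ}, 0 ≤ a → ∀ x y : Fin d → Bool,
      lsDist s (cubePoint x) (cubePoint y) ≤ a ↔ (hammingDist x y : ℝ) ≤ a ^ s := by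
    intro a ha x y
    rw [lsDist_cubePoint hs, one_div, Real.rpow_inv_le_iff_of_pos (Nat.cast_nonneg _) ha hs]
  refine half_le_rpow_mul_rpow_of_posSemidef hpsd h₀ h₁ hκ (a₁ := r ^ s) (a₂ := R ^ s)
    (by positivity) (by positivity) (by positivity) ?_ ?_ ?_ ?_ hε₁ ?_
  · intro x y
    exact pow_nonneg measureReal_nonneg _
  · intro x y
    refine pow_le_pow_left₀ measureReal_nonneg ?_ _
    exact (hsym.measureReal_eq _ _).symm.trans_le (hF.measureReal_le _ _)
  · intro x y hxy
    refine pow_le_pow_left₀ hp₁ ?_ _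
    exact (hF.close _ _ ((hdist hr x y).2 hxy)).trans_eq (hsym.measureReal_eq _ _)
  · intro x y hxy
    refine pow_le_pow_left₀ measureReal_nonneg ?_ _
    refine (hsym.measureReal_eq _ _).symm.trans_le (hF.far _ _ ?_)
    exact not_le.1 fun h => hxy.not_ge ((hdist hR x y).1 h)
  · simpa only [div_pow] using hε₂

end FilterFamily

/-! ### Choice of parameters -/

section NoiseTails

variable {ι : Type*} [Fintype ι] [DecidableEq ι]

/-- Chernoff with `t = g`: the mean is at most `τn/2`, and `g + g² - g(1 + 2g) = -g²`. -/
lemma sum_noiseKernel_upper_tail_le {g τ : ℝ} (hg : 0 ≤ g) (hg₁ : g ≤ 1) (hτ : 0 ≤ τ)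
    (x : ι → Bool) :
    ∑ y with (1 + 2 * g) * τ * Fintype.card ι / 2 ≤ (hammingDist x y : ℝ),
        noiseKernel (Real.exp (-τ)) x y ≤
      Real.exp (-(g ^ 2 * τ * Fintype.card ι / 2)) := by
  set n : ℝ := (Fintype.card ι : ℝ) with hn
  have hn₀ : 0 ≤ n := Nat.cast_nonneg _
  have h₁ : Real.exp (-τ) ≤ 1 := Real.exp_le_one_iff.2 (by linarith)
  have key := sum_noiseKernel_filter_le (Real.exp_pos _).le h₁ g ((1 + 2 * g) * τ * n / 2) x
  have hsub : ∑ y with (1 + 2 * g) * τ * n / 2 ≤ (hammingDist x y : ℝ),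
      noiseKernel (Real.exp (-τ)) x y ≤
      ∑ y with g * ((1 + 2 * g) * τ * n / 2) ≤ g * hammingDist x y,
        noiseKernel (Real.exp (-τ)) x y := by
    refine Finset.sum_le_sum_of_subset_of_nonneg (fun y hy => ?_) fun y _ _ =>
      noiseKernel_nonneg (Real.exp_pos _).le h₁ x y
    rw [Finset.mem_filter] at hy ⊢
    exact ⟨hy.1, mul_le_mul_of_nonneg_left hy.2 hg⟩
  refine (hsub.trans key).trans (Real.exp_le_exp.2 ?_)
  have hη : (1 - Real.exp (-τ)) / 2 ≤ τ / 2 := by linarith [Real.add_one_le_exp (-τ)]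
  have hexp : Real.exp g - 1 ≤ g + g ^ 2 := by
    have := Real.abs_exp_sub_one_sub_id_le (x := g) (by rwa [abs_of_nonneg hg])
    linarith [(abs_le.1 this).2]
  have hexp₀ : 0 ≤ Real.exp g - 1 := sub_nonneg.2 (Real.one_le_exp hg)
  have : (1 - Real.exp (-τ)) / 2 * (Real.exp g - 1) ≤ τ / 2 * (g + g ^ 2) :=
    mul_le_mul hη hexp hexp₀ (by positivity)
  nlinarith [mul_le_mul_of_nonneg_left this hn₀]

/-- Chernoff with `t = -g`. One factor `1 - g` absorbs the curvature of `exp(-σ)`, using `σ ≤ 2g`;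
the other is the deviation below the mean. -/
lemma sum_noiseKernel_lower_tail_le {g σ : ℝ} (hg : 0 ≤ g) (hg₁ : g ≤ 1 / 2) (hσ : 0 ≤ σ)
    (hσg : σ ≤ 2 * g) (x : ι → Bool) :
    ∑ y with (hammingDist x y : ℝ) ≤ (1 - g) ^ 2 * σ * Fintype.card ι / 2,
        noiseKernel (Real.exp (-σ)) x y ≤
      Real.exp (-(g ^ 2 * σ * Fintype.card ι / 8)) := by
  set n : ℝ := (Fintype.card ι : ℝ) with hn
  have hn₀ : 0 ≤ n := Nat.cast_nonneg _
  have h₁ : Real.exp (-σ) ≤ 1 := Real.exp_le_one_iff.2 (by linarith)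
  have key := sum_noiseKernel_filter_le (Real.exp_pos _).le h₁ (-g) ((1 - g) ^ 2 * σ * n / 2) x
  have hsub : ∑ y with (hammingDist x y : ℝ) ≤ (1 - g) ^ 2 * σ * n / 2,
      noiseKernel (Real.exp (-σ)) x y ≤
      ∑ y with -g * ((1 - g) ^ 2 * σ * n / 2) ≤ -g * hammingDist x y,
        noiseKernel (Real.exp (-σ)) x y := by
    refine Finset.sum_le_sum_of_subset_of_nonneg (fun y hy => ?_) fun y _ _ =>
      noiseKernel_nonneg (Real.exp_pos _).le h₁ x y
    rw [Finset.mem_filter] at hy ⊢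
    exact ⟨hy.1, mul_le_mul_of_nonpos_left hy.2 (neg_nonpos.2 hg)⟩
  refine (hsub.trans key).trans (Real.exp_le_exp.2 ?_)
  set η := (1 - Real.exp (-σ)) / 2 with hη'
  have hη : (1 - g) * σ / 2 ≤ η := by
    have := exp_neg_le_one_sub_add_sq hσ
    nlinarith
  have hη₀ : 0 ≤ η := by linarith
  have hexp : Real.exp (-g) - 1 ≤ -g + g ^ 2 / 2 := by linarith [exp_neg_le_one_sub_add_sq hg]
  have h₂ : η * (Real.exp (-g) - 1) ≤ η * (-g + g ^ 2 / 2) := mul_le_mul_of_nonneg_left hexp hη₀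
  have h₃ : g * ((1 - g) * ((1 - g) * σ / 2)) ≤ g * ((1 - g) * η) := by
    have : 0 ≤ 1 - g := by linarith
    gcongr
  have h₄ : g ^ 2 / 2 * (σ / 4) ≤ g ^ 2 / 2 * η := by
    have : σ / 4 ≤ η := by nlinarith
    gcongr
  have h₅ : η * (Real.exp (-g) - 1) + g * ((1 - g) * ((1 - g) * σ / 2)) ≤ -(g ^ 2 * σ / 8) := by
    nlinarith
  nlinarith [mul_le_mul_of_nonneg_left h₅ hn₀]

end NoiseTails

lemma exists_nat_mul_near {l M : ℝ} (hl : 0 < l) (hlM : l ≤ M) :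
    ∃ k : ℕ, 1 ≤ k ∧ k * l ≤ M ∧ M ≤ 2 * (k * l) := by
  have h₁ : 1 ≤ M / l := (one_le_div hl).2 hlM
  have hk : 1 ≤ ⌊M / l⌋₊ := (Nat.one_le_floor_iff _).2 h₁
  refine ⟨⌊M / l⌋₊, hk, ?_, ?_⟩
  · rw [← le_div_iff₀ hl]
    exact Nat.floor_le (by linarith)
  · have := (Nat.lt_floor_add_one (M / l)).le
    rw [div_le_iff₀ hl] at this
    have hk' : (1 : ℝ) ≤ ⌊M / l⌋₊ := by exact_mod_cast hk
    nlinarith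

/-- The factors 2 cost at most `2 log 2` after taking logarithms; dividing by `k log(1/q) ≥ M/2`
gives the error term. -/
lemma le_log_ratio_of_half_pow_le {p₁ p₂ pq κ M : ℝ} (hp₁ : 0 < p₁) (hp₂ : 0 < p₂) (hpq : p₂ < pq)
    (hκ : 1 ≤ κ) (hM : 0 < M) {k : ℕ} (hkM : M ≤ 2 * (k * Real.log (1 / (p₂ / pq))))
    (hle : p₁ ^ k / 2 ≤ (pq ^ k) ^ (1 - κ⁻¹) * (2 * p₂ ^ k) ^ κ⁻¹) :
    κ⁻¹ - 4 * Real.log 2 / M ≤ Real.log (1 / (p₁ / pq)) / Real.log (1 / (p₂ / pq)) := by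
  have hpq₀ : 0 < pq := hp₂.trans hpq
  have hlog2 : 0 < Real.log 2 := Real.log_pos one_lt_two
  have hκ' : κ⁻¹ ≤ 1 := inv_le_one_of_one_le₀ hκ
  have h := Real.log_le_log (by positivity) hle
  rw [Real.log_mul (by positivity) (by positivity), Real.log_rpow (by positivity),
    Real.log_rpow (by positivity), Real.log_mul (by positivity) (by positivity),
    Real.log_div (by positivity) (by positivity), Real.log_pow, Real.log_pow, Real.log_pow] at h
  have e : ∀ {x : ℝ}, 0 < x → Real.log (1 / (x / pq)) = Real.log pq - Real.log x := fun hx => by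
    rw [one_div_div, Real.log_div hpq₀.ne' hx.ne']
  rw [e hp₂] at hkM
  rw [e hp₁, e hp₂]
  set l := Real.log pq - Real.log p₂ with hl'
  set m := Real.log pq - Real.log p₁ with hm'
  have hl : 0 < l := sub_pos.2 (Real.log_lt_log hp₂ hpq)
  have hk : (0 : ℝ) < k := by
    by_contra hk
    nlinarith
  have h₁ : κ⁻¹ * (k * l) - 2 * Real.log 2 ≤ k * m := by
    nlinarith
  rw [le_div_iff₀ hl]
  refine le_of_mul_le_mul_left ?_ hk
  have h₂ : 2 * Real.log 2 ≤ 4 * Real.log 2 / M * (k * l) := by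
    rw [div_mul_eq_mul_div, le_div_iff₀ hM]
    nlinarith
  nlinarith

/-- The correlation exponent `κ` used against the approximation factor `A = c ^ s` at slack `g`. -/
noncomputable def noiseExponent (A g : ℝ) : ℝ := A * (1 + 2 * g) / (1 - g) ^ 2

/-- The radius used in dimension `d` at slack `g`. -/
noncomputable def cubeRadius (s g : ℝ) (d : ℕ) : ℝ := ((1 + 2 * g) * g ^ 4 * d / 2) ^ (1 / s)

lemma cubeRadius_nonneg {s g : ℝ} (hg : 0 ≤ g) (d : ℕ) : 0 ≤ cubeRadius s g d := by
  unfold cubeRadius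
  positivity

lemma cubeRadius_rpow {s g : ℝ} (hs : 0 < s) (hg : 0 ≤ g) (d : ℕ) :
    cubeRadius s g d ^ s = (1 + 2 * g) * g ^ 4 * d / 2 := by
  rw [cubeRadius, one_div, Real.rpow_inv_rpow (by positivity) hs.ne']

namespace FilterFamily

variable {p₁ p₂ pq pu : ℝ} {d : ℕ} {F : FilterFamily (Fin d → ℝ)}

/-- The lower bound on `ρ` in a fixed dimension, with explicit error terms. -/
lemma IsSensitive.le_log_ratio {c s g : ℝ} (hc : 1 < c) (hs : 0 < s) (hsym : F.IsSymmetric)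
    (hF : F.IsSensitive (lsDist s) (cubeRadius s g d) (c * cubeRadius s g d) p₁ p₂ pq pu)
    (hp₁ : 0 < p₁) (hp₂ : 0 < p₂) (hpq : p₂ < pq)
    (hg : 0 < g) (hg₁ : g ^ 2 ≤ 1 / 8) (hκg : noiseExponent (c ^ s) g * g ^ 3 ≤ 2)
    (hd : 2 * Real.log 2 ≤ g ^ 6 * d)
    (hq : (2 : ℝ) ^ (-(g ^ 8 * d)) ≤ p₂ / pq) :
    (noiseExponent (c ^ s) g)⁻¹ - 4 / (g ^ 8 * d) ≤
      Real.log (1 / (p₁ / pq)) / Real.log (1 / (p₂ / pq)) := by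
  have hpq₀ : 0 < pq := hp₂.trans hpq
  have hlog2 : 0 < Real.log 2 := Real.log_pos one_lt_two
  have hlog2' : Real.log 2 ≤ 1 := by linarith [Real.log_two_lt_d9]
  have hg₂ : g ≤ 1 / 2 := by nlinarith
  have hA : 1 < c ^ s := Real.one_lt_rpow hc hs
  set A := c ^ s
  set κ := noiseExponent A g with hκ_def
  have hsq : 0 < (1 - g) ^ 2 := by
    have : 0 < 1 - g := by linarith
    positivity
  have hκA : (1 - g) ^ 2 * κ = A * (1 + 2 * g) := by
    rw [hκ_def, noiseExponent, mul_div_cancel₀ _ hsq.ne']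
  have hκ : 1 ≤ κ := by
    rw [hκ_def, noiseExponent, one_le_div hsq]
    nlinarith
  have hd₀ : (0 : ℝ) < d := by
    by_contra h
    nlinarith [pow_pos hg 6]
  -- The largest `log(1/q)` that `hq` permits, so some `k ≥ 1` fits below it.
  set M := g ^ 8 * d * Real.log 2 with hM_def
  have hM : 0 < M := by positivity
  set l := Real.log (1 / (p₂ / pq)) with hl_def
  have hl : 0 < l := Real.log_pos (by rwa [one_div_div, one_lt_div hp₂])
  have hl' : l = -Real.log (p₂ / pq) := by rw [hl_def, one_div, Real.log_inv]
  have hlM : l ≤ M := by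
    have := Real.log_le_log (by positivity) hq
    rw [Real.log_rpow two_pos] at this
    linarith
  obtain ⟨k, hk, hk₁, hk₂⟩ := exists_nat_mul_near hl hlM
  have hr := cubeRadius_nonneg (s := s) hg.le d
  have hrs := cubeRadius_rpow hs hg.le d
  have hle := hF.half_pow_le hs hsym hr (mul_nonneg (by linarith) hr) hp₁.le hp₂.le hpq₀ hk
    (Real.exp_pos (-(g ^ 4))).le (Real.exp_le_one_iff.2 (by simp; positivity)) hκ
    (fun x => by
      have := sum_noiseKernel_upper_tail_le hg.le (by linarith) (pow_nonneg hg.le 4) x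
      rw [Fintype.card_fin] at this
      rw [hrs]
      refine this.trans ?_
      rw [← Real.le_log_iff_exp_le (by norm_num), one_div, Real.log_inv]
      linarith [show g ^ 2 * g ^ 4 * d = g ^ 6 * d by ring])
    (fun x => by
      have := sum_noiseKernel_lower_tail_le hg.le hg₂ (σ := g ^ 4 * κ) (by positivity)
        (by nlinarith) x
      rw [Fintype.card_fin] at this
      rw [Real.mul_rpow (by linarith) hr, hrs, ← Real.exp_mul, neg_mul]
      -- `noiseExponent` is defined so that `(cr)^s` is exactly the lower-tail threshold at
      -- correlation `ρ^κ`.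
      have e : A * ((1 + 2 * g) * g ^ 4 * d / 2) = (1 - g) ^ 2 * (g ^ 4 * κ) * d / 2 := by
        linear_combination (-(g ^ 4 * d / 2)) * hκA
      rw [e]
      refine this.trans ?_
      rw [← Real.exp_log (div_pos hp₂ hpq₀), ← Real.exp_nat_mul]
      refine Real.exp_le_exp.2 ?_
      rw [show Real.log (p₂ / pq) = -l by linarith, mul_neg, neg_le_neg_iff]
      refine hk₁.trans ?_
      -- The tail exponent `g⁶κd/8` exceeds `M`, of order `g⁸d`, because `g² ≤ 1/8` and `κ ≥ 1`.
      have h₁ : g ^ 2 * (g ^ 6 * d) ≤ 1 / 8 * (g ^ 6 * d) := by gcongr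
      have h₂ : g ^ 6 * d * 1 ≤ g ^ 6 * d * κ := by gcongr
      have h₃ : M ≤ g ^ 8 * d := mul_le_of_le_one_right (by positivity) hlog2'
      nlinarith)
  refine le_trans (le_of_eq ?_) (le_log_ratio_of_half_pow_le hp₁ hp₂ hpq hκ hM hk₂ hle)
  rw [hM_def, mul_div_mul_right _ _ hlog2.ne']

/-- Covers the finitely many dimensions in which the slack is not yet small enough. -/
lemma IsSensitive.log_ratio_nonneg {r R s : ℝ} (hs : 0 < s) (hr : 0 ≤ r)
    (hF : F.IsSensitive (lsDist s) r R p₁ p₂ pq pu)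
    (hp₁ : 0 < p₁) (hp₂ : 0 < p₂) (hpq : p₂ < pq) :
    0 ≤ Real.log (1 / (p₁ / pq)) / Real.log (1 / (p₂ / pq)) := by
  have h : p₁ ≤ pq := (hF.close 0 0 (by simp [lsDist, hs.ne', hr])).trans (hF.measureReal_le 0 0)
  rw [one_div_div, one_div_div]
  exact div_nonneg (Real.log_nonneg ((one_le_div hp₁).2 h))
    (Real.log_nonneg ((one_le_div hp₂).2 hpq.le))

end FilterFamily

/-- The slack used in dimension `d`: it dominates `|δ d| ^ (1 / 8)` and decays slowly. -/
noncomputable def cubeSlack (δ : ℕ → ℝ) (d : ℕ) : ℝ :=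
  |δ d| ^ (1 / 8 : ℝ) + ((d : ℝ) + 1) ^ (-(1 / 16) : ℝ)

section Slack

variable {δ : ℕ → ℝ}

lemma cubeSlack_pos (d : ℕ) : 0 < cubeSlack δ d := by
  unfold cubeSlack
  positivity

lemma abs_le_cubeSlack_pow (d : ℕ) : |δ d| ≤ cubeSlack δ d ^ 8 := by
  calc |δ d| = (|δ d| ^ (1 / 8 : ℝ)) ^ 8 := by
        rw [← Real.rpow_mul_natCast (abs_nonneg _)]
        norm_num
    _ ≤ _ := by
        refine pow_le_pow_left₀ (by positivity) (le_add_of_nonneg_right (by positivity)) _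

lemma tendsto_cubeSlack (hδ : Tendsto δ atTop (𝓝 0)) : Tendsto (cubeSlack δ) atTop (𝓝 0) := by
  have h₁ : Tendsto (fun d => |δ d| ^ (1 / 8 : ℝ)) atTop (𝓝 0) := by
    have := hδ.abs.rpow_const (p := (1 / 8 : ℝ)) (Or.inr (by norm_num))
    simpa using this
  have h₂ : Tendsto (fun d : ℕ => ((d : ℝ) + 1) ^ (-(1 / 16) : ℝ)) atTop (𝓝 0) :=
    (tendsto_rpow_neg_atTop (by norm_num)).comp
      (tendsto_atTop_add_const_right _ _ tendsto_natCast_atTop_atTop)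
  exact add_zero (0 : ℝ) ▸ h₁.add h₂

/-- The second summand of the slack alone contributes `(d+1)^(-1/2)` to the eighth power, leaving
growth of order `√d`. -/
lemma tendsto_cubeSlack_pow_mul :
    Tendsto (fun d : ℕ => cubeSlack δ d ^ 8 * d) atTop atTop := by
  have h : Tendsto (fun d : ℕ => ((d : ℝ) + 1) ^ (1 / 2 : ℝ) - 1) atTop atTop :=
    tendsto_atTop_add_const_right _ _ ((tendsto_rpow_atTop (by norm_num)).comp
      (tendsto_atTop_add_const_right _ _ tendsto_natCast_atTop_atTop))
  refine tendsto_atTop_mono (fun d => ?_) h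
  have hd : (0 : ℝ) < (d : ℝ) + 1 := by positivity
  have h₁ : ((d : ℝ) + 1) ^ (-(1 / 2) : ℝ) ≤ cubeSlack δ d ^ 8 := by
    calc _ = (((d : ℝ) + 1) ^ (-(1 / 16) : ℝ)) ^ 8 := by
          rw [← Real.rpow_mul_natCast hd.le]
          norm_num
      _ ≤ _ := pow_le_pow_left₀ (by positivity) (le_add_of_nonneg_left (by positivity)) _
  have h₂ : ((d : ℝ) + 1) ^ (-(1 / 2) : ℝ) ≤ 1 :=
    Real.rpow_le_one_of_one_le_of_nonpos (by linarith [d.cast_nonneg (α := ℝ)]) (by norm_num)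
  have h₃ : ((d : ℝ) + 1) ^ (-(1 / 2) : ℝ) * ((d : ℝ) + 1) = ((d : ℝ) + 1) ^ (1 / 2 : ℝ) := by
    rw [← Real.rpow_add_one hd.ne']
    norm_num
  nlinarith [mul_le_mul_of_nonneg_right h₁ (d.cast_nonneg (α := ℝ))]

lemma tendsto_noiseExponent_cubeSlack (hδ : Tendsto δ atTop (𝓝 0)) (A : ℝ) :
    Tendsto (fun d => noiseExponent A (cubeSlack δ d)) atTop (𝓝 A) := by
  have : ContinuousAt (noiseExponent A) 0 := by
    unfold noiseExponent
    exact ContinuousAt.div (by fun_prop) (by fun_prop) (by norm_num)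
  have h := this.tendsto.comp (tendsto_cubeSlack hδ)
  simpa [noiseExponent, Function.comp_def] using h

end Slack

theorem theorem1p4 (c s : ℝ) (hc : 1 < c) (hs : 0 < s)
    (δ : ℕ → ℝ) (hδ : Tendsto δ atTop (𝓝 0)) :
    ∃ r ε : ℕ → ℝ,
      Tendsto r atTop atTop ∧
      Tendsto (fun d : ℕ => r d ^ s / (d : ℝ)) atTop (𝓝 0) ∧
      Tendsto ε atTop (𝓝 0) ∧
      ∀ (d : ℕ) (F : FilterFamily (Fin d → ℝ)) (p₁ p₂ pq pu : ℝ),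
        F.IsSymmetric →
        F.IsSensitive (lsDist s) (r d) (c * r d) p₁ p₂ pq pu →
        0 < p₁ → 0 < p₂ → p₂ < pq →
        (2 : ℝ) ^ (-(δ d * (d : ℝ))) ≤ p₂ / pq →
        Real.log (1 / (p₁ / pq)) / Real.log (1 / (p₂ / pq)) ≥ 1 / c ^ s - ε d := by
  classical
  have hA : 1 < c ^ s := Real.one_lt_rpow hc hs
  have hA₀ : 0 < c ^ s := by linarith
  set g := cubeSlack δ with hg_def
  have hg : ∀ d, 0 < g d := cubeSlack_pos
  have hg₀ : Tendsto g atTop (𝓝 0) := tendsto_cubeSlack hδ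
  have hgd : Tendsto (fun d : ℕ => g d ^ 8 * d) atTop atTop := tendsto_cubeSlack_pow_mul
  have hκ : Tendsto (fun d => noiseExponent (c ^ s) (g d)) atTop (𝓝 (c ^ s)) :=
    tendsto_noiseExponent_cubeSlack hδ _
  have hg1 : ∀ᶠ d in atTop, g d ≤ 1 := hg₀.eventually_le_const one_pos
  have hpow : ∀ m, m ≤ 8 → Tendsto (fun d : ℕ => g d ^ m * d) atTop atTop := fun m hm => by
    refine tendsto_atTop_mono' _ ?_ hgd
    filter_upwards [hg1] with d hd
    exact mul_le_mul_of_nonneg_right (pow_le_pow_of_le_one (hg d).le hd hm) d.cast_nonneg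
  let Good : ℕ → Prop := fun d => g d ^ 2 ≤ 1 / 8 ∧ noiseExponent (c ^ s) (g d) * g d ^ 3 ≤ 2 ∧
    2 * Real.log 2 ≤ g d ^ 6 * d
  have hGood : ∀ᶠ d in atTop, Good d := by
    have h₂ : Tendsto (fun d => g d ^ 2) atTop (𝓝 0) := by simpa using hg₀.pow 2
    have h₃ : Tendsto (fun d => noiseExponent (c ^ s) (g d) * g d ^ 3) atTop (𝓝 0) := by
      simpa using hκ.mul (hg₀.pow 3)
    exact (h₂.eventually_le_const (by norm_num)).and
      ((h₃.eventually_le_const (by norm_num)).and ((hpow 6 (by norm_num)).eventually_ge_atTop _))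
  -- Outside `Good` the error 1 suffices, since `1 / c ^ s ≤ 1` and the ratio is nonnegative.
  refine ⟨fun d => cubeRadius s (g d) d, fun d => if Good d then
    1 / c ^ s - (noiseExponent (c ^ s) (g d))⁻¹ + 4 / (g d ^ 8 * d) else 1, ?_, ?_, ?_, ?_⟩
  · refine (tendsto_rpow_atTop (one_div_pos.2 hs)).comp ?_
    refine tendsto_atTop_mono (fun d => ?_)
      ((hpow 4 (by norm_num)).atTop_div_const (zero_lt_two (α := ℝ)))
    have := hg d
    gcongr
    nlinarith [pow_pos this 4]
  · have : Tendsto (fun d => (1 + 2 * g d) * g d ^ 4 / 2) atTop (𝓝 0) := by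
      simpa using ((hg₀.const_mul 2).const_add 1).mul (hg₀.pow 4) |>.div_const 2
    refine this.congr' ?_
    filter_upwards [eventually_ne_atTop 0] with d hd
    have hd' : (d : ℝ) ≠ 0 := by exact_mod_cast hd
    rw [cubeRadius_rpow hs (hg d).le]
    field_simp
  · have : Tendsto (fun d => 1 / c ^ s - (noiseExponent (c ^ s) (g d))⁻¹ + 4 / (g d ^ 8 * d))
        atTop (𝓝 0) := by
      have h := ((hκ.inv₀ hA₀.ne').const_sub (1 / c ^ s)).add (hgd.const_div_atTop 4)
      simpa using h
    refine this.congr' ?_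
    filter_upwards [hGood] with d hd
    rw [if_pos hd]
  · intro d F p₁ p₂ pq pu hsym hF hp₁ hp₂ hpq hq
    dsimp only at hF ⊢
    split_ifs with h
    · have hq' : (2 : ℝ) ^ (-(g d ^ 8 * d)) ≤ p₂ / pq := by
        refine le_trans (Real.rpow_le_rpow_of_exponent_le one_le_two ?_) hq
        exact neg_le_neg (mul_le_mul_of_nonneg_right
          ((le_abs_self _).trans (abs_le_cubeSlack_pow d)) d.cast_nonneg)
      have := hF.le_log_ratio hc hs hsym hp₁ hp₂ hpq (hg d) h.1 h.2.1 h.2.2 hq'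
      linarith
    · have h₀ := hF.log_ratio_nonneg hs (cubeRadius_nonneg (hg d).le d) hp₁ hp₂ hpq
      have h₁ : 1 / c ^ s ≤ 1 := by
        rw [div_le_one hA₀]
        exact hA.le
      linarith
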